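/- Let $n,m,N,N_s$ be natural numbers with $N_s\ge 3$, let $A\in\mathbb R^{n\times n}$, $B\in\mathbb R^{n\times m}$, $x(0)\in\mathbb R^n$, and let $U=(u(0),\dots,u(N-1))\in\mathbb R^{Nm}$ be a deterministic input sequence. Let $W^{[1]},\dots,W^{[N_s]}$ be independent samples from one (possibly singular) Gaussian distribution on $\mathbb R^{Nn}$, the distribution of the concatenated disturbance $W=(w(0),\dots,w(N-1))$ of the system $x(t+1)=Ax(t)+Bu(t)+w(t)$. For $1\le k\le N$ let $$x(k)^{[j]}=A^kx(0)+\sum_{t=0}^{k-1}A^{k-1-t}\bigl(Bu(t)+w(t)^{[j]}\bigr)$$ be the corresponding samples of the state at time $k$. Let $G\in\mathbb R^n$ be a (row) vector, put $y_j=G\,x(k)^{[j]}$, $$\hat\mu=\frac1{N_s}\sum_{j=1}^{N_s}y_j,\qquad \hat s=\sqrt{\frac1{N_s}\sum_{j=1}^{N_s}(y_j-\hat\mu)^2},$$ and assume that $\hat s>0$ almost surely. Then for every $i\in\{1,\dots,N_s\}$ the studentized residual $z^{[i]}=(y_i-\hat\mu)/\hat s$ has the Lebesgue density $$\phi(z)=\frac{\Gamma\left(\frac{N_s-1}{2}\right)}{\sqrt{\pi(N_s-1)}\,\Gamma\left(\frac{N_s-2}{2}\right)}\left(1-\frac{z^2}{N_s-1}\right)^{\frac{N_s-4}{2}}\quad\text{for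 } |z|\le\sqrt{N_s-1},\qquad \phi(z)=0\ \text{ otherwise}.$$ If moreover $N_s\ge4$, then $\phi$ is log-concave on $\mathbb R$ (that is, $\phi(x)^a\phi(y)^b\le\phi(ax+by)$ for all real $x,y$ and all $a,b\ge0$ with $a+b=1$), and the distribution of $z^{[i]}$ is unimodal, i.e. there is $c\in\mathbb R$ such that its distribution function is convex on $(-\infty,c)$ and concave on $(c,\infty)$. -/

import Mathlib

open MeasureTheory ProbabilityTheory Set

noncomputable section

namespace LTI

/-- The matrix `𝒞(k) = [A^{k-1}B … AB B 0 … 0]`; the `t`-th block of columns (`t < N`) is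
`A^{k-1-t} B` for `t < k` and zero for `t ≥ k`. -/
def inputMatrix {n m : ℕ} (N : ℕ) (A : Matrix (Fin n) (Fin n) ℝ) (B : Matrix (Fin n) (Fin m) ℝ)
    (k : ℕ) : Matrix (Fin n) (Fin N × Fin m) ℝ :=
  Matrix.of fun r c => if (c.1 : ℕ) < k then (A ^ (k - 1 - (c.1 : ℕ)) * B) r c.2 else 0

/-- The matrix `𝒟(k) = [A^{k-1} … A I 0 … 0]`, with the same block convention. -/
def disturbanceMatrix {n : ℕ} (N : ℕ) (A : Matrix (Fin n) (Fin n) ℝ)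
    (k : ℕ) : Matrix (Fin n) (Fin N × Fin n) ℝ :=
  Matrix.of fun r c => if (c.1 : ℕ) < k then (A ^ (k - 1 - (c.1 : ℕ))) r c.2 else 0

/-- The state `x(k) = A^k x(0) + 𝒞(k) U + 𝒟(k) W` at time `k ≤ N` of the system
`x(k+1) = A x(k) + B u(k) + w(k)`, for the concatenated input `U = (u(0), …, u(N-1))` and the
concatenated disturbance `W = (w(0), …, w(N-1))`. -/
def state {n m N : ℕ} (A : Matrix (Fin n) (Fin n) ℝ) (B : Matrix (Fin n) (Fin m) ℝ)
    (x₀ : Fin n → ℝ) (U : Fin N × Fin m → ℝ) (W : Fin N × Fin n → ℝ) (k : ℕ) : Fin n → ℝ :=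
  (A ^ k).mulVec x₀ + (inputMatrix N A B k).mulVec U + (disturbanceMatrix N A k).mulVec W

end LTI

/-- Sample mean. -/
def sampleMean {Ns : ℕ} (y : Fin Ns → ℝ) : ℝ := (1 / (Ns : ℝ)) * ∑ j, y j

/-- Sample standard deviation, without Bessel's correction. -/
def sampleStd {Ns : ℕ} (y : Fin Ns → ℝ) : ℝ :=
  √((1 / (Ns : ℝ)) * ∑ j, (y j - sampleMean y) ^ 2)

/-- The studentized residual of the `j`-th sample. -/
def studentizedResidual {Ns : ℕ} (y : Fin Ns → ℝ) (j : Fin Ns) : ℝ :=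
  (y j - sampleMean y) / sampleStd y

/-- The density `Γ((Ns-1)/2) / (√(π(Ns-1)) Γ((Ns-2)/2)) · (1 - z²/(Ns-1))^((Ns-4)/2)`
on `|z| ≤ √(Ns-1)`, and `0` elsewhere. -/
def residualPDF (Ns : ℕ) (z : ℝ) : ℝ :=
  if |z| ≤ √((Ns : ℝ) - 1) then
    Real.Gamma (((Ns : ℝ) - 1) / 2) /
        (√(Real.pi * ((Ns : ℝ) - 1)) * Real.Gamma (((Ns : ℝ) - 2) / 2)) *
      (1 - z ^ 2 / ((Ns : ℝ) - 1)) ^ (((Ns : ℝ) - 4) / 2)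
  else 0

/-- A function `f : ℝ → [0, ∞)` is log-concave if `f(x)^a f(y)^b ≤ f(ax + by)` for all `x`, `y`
and all `a, b ≥ 0` with `a + b = 1`. -/
def IsLogConcave (f : ℝ → ℝ) : Prop :=
  (∀ x, 0 ≤ f x) ∧
    ∀ x y a b : ℝ, 0 ≤ a → 0 ≤ b → a + b = 1 → f x ^ a * f y ^ b ≤ f (a * x + b * y)

/-- A probability measure on `ℝ` is unimodal if, for some mode `c`, its distribution function is
convex on `(-∞, c)` and concave on `(c, ∞)`. -/
def IsUnimodal (μ : Measure ℝ) : Prop :=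
  ∃ c : ℝ, ConvexOn ℝ (Iio c) (fun x => μ.real (Iic x)) ∧
    ConcaveOn ℝ (Ioi c) (fun x => μ.real (Iic x))

end

/-! Each `G ⬝ᵥ x(k)` is an affine function of the disturbance, so the `y_j` are independent samples
of one real Gaussian; almost sure positivity of `ŝ` excludes zero variance. The residual does not
change under `y ↦ m + s y` with `s > 0`, so the samples may be taken standard normal
(`studentizedResidual_const_add_mul`).

Put `d = Ns - 2`. In an orthonormal basis whose first vector is the constant direction and whose
second is the normalized centred `i`-th unit vector, the standard Gaussian keeps its law. With
coordinates `a`, the mean only sees `a 0`, and the residual becomes `√(d+1) a₁ / √(a₁² + ‖z‖²)`,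
where `z` consists of the other `d` coordinates. The ratio `t = a₁ / ‖z‖` has a scaled Student
density, and the substitution `√(d+1) t / √(1+t²)` turns it into `residualPDF`.

For `Ns ≥ 4` the exponent in the density is nonnegative, which gives log-concavity and monotonicity
in `|z|`, hence unimodality. -/

/-! ### Gaussian densities and the ratio law. -/

/-- The standard Gaussian measure has the usual density with respect to the volume. -/
lemma stdGaussian_eq_withDensity (E : Type*) [NormedAddCommGroup E] [InnerProductSpace ℝ E]
    [FiniteDimensional ℝ E] [MeasurableSpace E] [BorelSpace E] :
    stdGaussian E = volume.withDensity (fun z : E => ENNReal.ofReal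
      ((2 * Real.pi) ^ (-(Module.finrank ℝ E / 2 : ℝ)) * Real.exp (-(1 / 2) * ‖z‖ ^ 2))) := by
  have hpi : (0 : ℝ) < 2 * Real.pi := by positivity
  have hmeas : Measurable (fun z : E =>
      (2 * Real.pi) ^ (-(Module.finrank ℝ E / 2 : ℝ)) * Real.exp (-(1 / 2) * ‖z‖ ^ 2)) := by
    fun_prop
  have hint : Integrable (fun z : E =>
      (2 * Real.pi) ^ (-(Module.finrank ℝ E / 2 : ℝ)) * Real.exp (-(1 / 2) * ‖z‖ ^ 2)) := by
    apply Integrable.const_mul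
    have h := (GaussianFourier.integrable_cexp_neg_mul_sq_norm_add (b := 1 / 2) (by norm_num) 0
      (0 : E)).norm
    refine h.congr (ae_of_all _ fun z => ?_)
    simp only [Complex.norm_exp]
    congr 1
    simp [← Complex.ofReal_pow]
  have : IsFiniteMeasure (volume.withDensity (fun z : E => ENNReal.ofReal
      ((2 * Real.pi) ^ (-(Module.finrank ℝ E / 2 : ℝ)) * Real.exp (-(1 / 2) * ‖z‖ ^ 2)))) :=
    isFiniteMeasure_withDensity_ofReal hint.2
  apply Measure.ext_of_charFun
  ext t
  rw [charFun_stdGaussian, charFun_apply, integral_withDensity_eq_integral_toReal_smul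
    hmeas.ennreal_ofReal (ae_of_all _ fun _ => ENNReal.ofReal_lt_top)]
  have h := GaussianFourier.integral_cexp_neg_mul_sq_norm_add (b := 1 / 2) (by norm_num)
    Complex.I t
  calc Complex.exp (-‖t‖ ^ 2 / 2)
      = ((2 * Real.pi) ^ (-(Module.finrank ℝ E / 2 : ℝ)) : ℝ) *
        ∫ v : E, Complex.exp (-(1 / 2) * ‖v‖ ^ 2 + Complex.I * (inner ℝ t v : ℝ)) := by
        rw [h]
        have h2 : ((Real.pi : ℂ) / (1 / 2)) ^ (Module.finrank ℝ E / 2 : ℂ)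
            = (((2 * Real.pi) ^ (Module.finrank ℝ E / 2 : ℝ) : ℝ) : ℂ) := by
          rw [Complex.ofReal_cpow hpi.le]
          push_cast
          congr 1
          ring
        rw [h2, ← mul_assoc, ← Complex.ofReal_mul, ← Real.rpow_add hpi]
        simp only [neg_add_cancel, Real.rpow_zero, Complex.ofReal_one, one_mul, Complex.I_sq]
        congr 1
        ring
    _ = _ := by
        rw [← integral_const_mul]
        congr 1 with v
        rw [ENNReal.toReal_ofReal (by positivity), Complex.exp_add, real_inner_comm,
          Complex.real_smul]
        push_cast
        ring_nf

/-- Polar coordinates reduce this to a Gamma integral. The factor `‖z‖` is the Jacobian of `v = ‖z‖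
t` in the ratio law below, which uses `b = (1 + t²) / 2`. -/
lemma lintegral_norm_mul_exp_neg_mul_sq {E : Type*} [NormedAddCommGroup E]
    [InnerProductSpace ℝ E] [FiniteDimensional ℝ E] [MeasurableSpace E] [BorelSpace E]
    [Nontrivial E] {b : ℝ} (hb : 0 < b) :
    ∫⁻ z : E, ENNReal.ofReal (‖z‖ * Real.exp (-b * ‖z‖ ^ 2)) =
      ENNReal.ofReal (Real.pi ^ (Module.finrank ℝ E / 2 : ℝ) / Real.Gamma (Module.finrank ℝ E / 2) *
        b ^ (-((Module.finrank ℝ E + 1) / 2 : ℝ)) *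
          Real.Gamma ((Module.finrank ℝ E + 1) / 2)) := by
  have hd : 0 < Module.finrank ℝ E := Module.finrank_pos
  set d := Module.finrank ℝ E with hdd
  have hd' : (0 : ℝ) < d := by exact_mod_cast hd
  have key : ∀ y ∈ Ioi (0 : ℝ), y ^ (d - 1) • (y * Real.exp (-b * y ^ 2))
      = y ^ (d : ℝ) * Real.exp (-b * y ^ (2 : ℝ)) := by
    intro y hy
    rw [smul_eq_mul, ← mul_assoc, ← pow_succ, Nat.sub_add_cancel hd, Real.rpow_natCast]
    norm_num
  have hint : Integrable (fun z : E => ‖z‖ * Real.exp (-b * ‖z‖ ^ 2)) := by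
    rw [integrable_fun_norm_addHaar volume (f := fun y => y * Real.exp (-b * y ^ 2)),
      integrableOn_congr_fun key measurableSet_Ioi]
    exact integrableOn_rpow_mul_exp_neg_mul_rpow (by linarith) (by norm_num) hb
  rw [← ofReal_integral_eq_lintegral_ofReal hint (ae_of_all _ fun z => by positivity),
    integral_fun_norm_addHaar volume (fun y => y * Real.exp (-b * y ^ 2)),
    setIntegral_congr_fun measurableSet_Ioi key,
    integral_rpow_mul_exp_neg_mul_rpow (by norm_num) (by linarith) hb]
  congr 1
  have hball : volume.real (Metric.ball (0 : E) 1)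
      = Real.pi ^ (d / 2 : ℝ) / ((d / 2 : ℝ) * Real.Gamma (d / 2)) := by
    rw [Measure.real, InnerProductSpace.volume_ball, Real.Gamma_add_one (by positivity),
      Real.sqrt_eq_rpow, ← Real.rpow_natCast, ← Real.rpow_mul Real.pi_pos.le, ← hdd]
    simp only [ENNReal.ofReal_one, one_pow, one_mul]
    rw [ENNReal.toReal_ofReal (by positivity)]
    congr 2
    ring
  have hG : Real.Gamma (d / 2 : ℝ) ≠ 0 := (Real.Gamma_pos_of_pos (by positivity)).ne'
  rw [hball, ← hdd, nsmul_eq_mul, smul_eq_mul, neg_div]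
  field_simp

/-- The law of `v / ‖z‖` for independent standard Gaussian `v : ℝ` and `z : E` is Student's
distribution up to scaling; stated for functions of `v` and `z` which only depend on `v / ‖z‖`. -/
lemma lintegral_gaussianReal_prod_stdGaussian {E : Type*} [NormedAddCommGroup E]
    [InnerProductSpace ℝ E] [FiniteDimensional ℝ E] [MeasurableSpace E] [BorelSpace E]
    [Nontrivial E] {F : ℝ × E → ENNReal} (hF : Measurable F) {g : ℝ → ENNReal} (hg : Measurable g)
    (hFg : ∀ z : E, z ≠ 0 → ∀ t : ℝ, F (‖z‖ * t, z) = g t) :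
    ∫⁻ p, F p ∂((gaussianReal 0 1).prod (stdGaussian E)) =
      ∫⁻ t, g t * ENNReal.ofReal (Real.Gamma ((Module.finrank ℝ E + 1) / 2) /
        (√Real.pi * Real.Gamma (Module.finrank ℝ E / 2)) *
          (1 + t ^ 2) ^ (-((Module.finrank ℝ E + 1) / 2 : ℝ))) := by
  set d := Module.finrank ℝ E with hdd
  have hd' : (0 : ℝ) < d := by exact_mod_cast (Module.finrank_pos : 0 < Module.finrank ℝ E)
  have hpi := Real.pi_pos
  rw [lintegral_prod_symm' _ hF, stdGaussian_eq_withDensity,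
    lintegral_withDensity_eq_lintegral_mul₀ (by fun_prop) (by fun_prop)]
  simp only [← hdd, Pi.mul_apply]
  set c : ℝ := (2 * Real.pi) ^ (-((d + 1) / 2 : ℝ)) with hc
  have inner_eq : ∀ z : E, z ≠ 0 →
      ENNReal.ofReal ((2 * Real.pi) ^ (-(d / 2 : ℝ)) * Real.exp (-(1 / 2) * ‖z‖ ^ 2)) *
        ∫⁻ v, F (v, z) ∂(gaussianReal 0 1)
      = ∫⁻ t, g t * ENNReal.ofReal (c * (‖z‖ * Real.exp (-((1 + t ^ 2) / 2) * ‖z‖ ^ 2))) := by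
    intro z hz
    have hz' : 0 < ‖z‖ := norm_pos_iff.2 hz
    have hFz : Measurable fun v => F (v, z) := by fun_prop
    rw [gaussianReal_of_var_ne_zero _ one_ne_zero, lintegral_withDensity_eq_lintegral_mul _
      (measurable_gaussianPDF _ _) hFz]
    -- Substitute `v = ‖z‖ t` at fixed `z`, so that the test function depends on `t` alone.
    conv_lhs => rw [← Real.smul_map_volume_mul_left hz'.ne']
    rw [lintegral_smul_measure, lintegral_map (by fun_prop) (by fun_prop), smul_eq_mul, ← mul_assoc,
      ← lintegral_const_mul _ (by fun_prop)]
    congr 1 with t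
    simp only [Pi.mul_apply, hFg z hz, gaussianPDF, gaussianPDFReal]
    rw [← ENNReal.ofReal_mul (by positivity), ← mul_assoc, ← ENNReal.ofReal_mul (by positivity),
      mul_comm]
    congr 2
    have h1 : c = (2 * Real.pi) ^ (-(d / 2 : ℝ)) * (√(2 * Real.pi))⁻¹ := by
      rw [Real.sqrt_eq_rpow, ← Real.rpow_neg (by positivity), ← Real.rpow_add (by positivity), hc]
      congr 1
      ring
    have h2 : Real.exp (-((1 + t ^ 2) / 2) * ‖z‖ ^ 2)
        = Real.exp (-(1 / 2) * ‖z‖ ^ 2) * Real.exp (-(‖z‖ * t - 0) ^ 2 / (2 * 1)) := by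
      rw [← Real.exp_add]
      congr 1
      ring
    rw [h1, h2, abs_of_pos hz']
    simp only [NNReal.coe_one, mul_one]
    ring
  rw [lintegral_congr_ae (g := fun z : E => ∫⁻ t, g t *
      ENNReal.ofReal (c * (‖z‖ * Real.exp (-((1 + t ^ 2) / 2) * ‖z‖ ^ 2))))
    (by
      have : ∀ᵐ z : E, z ≠ 0 := by simp [ae_iff]
      filter_upwards [this] with z hz using inner_eq z hz),
    lintegral_lintegral_swap (by fun_prop)]
  congr 1 with t
  rw [lintegral_const_mul _ (by fun_prop)]
  congr 1
  have ht : 0 < 1 + t ^ 2 := by positivity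
  simp_rw [ENNReal.ofReal_mul (show 0 ≤ c by positivity)]
  rw [lintegral_const_mul _ (by fun_prop), lintegral_norm_mul_exp_neg_mul_sq (by positivity),
    ← ENNReal.ofReal_mul (by positivity), ← hdd]
  congr 1
  have hG : Real.Gamma (d / 2 : ℝ) ≠ 0 := (Real.Gamma_pos_of_pos (by positivity)).ne'
  rw [hc, Real.mul_rpow (by norm_num) hpi.le, Real.div_rpow ht.le (by norm_num)]
  have h3 : Real.pi ^ (-((d + 1) / 2 : ℝ)) * Real.pi ^ (d / 2 : ℝ) = (√Real.pi)⁻¹ := by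
    rw [Real.sqrt_eq_rpow, ← Real.rpow_neg hpi.le, ← Real.rpow_add hpi]
    congr 1
    ring
  have h4 : (2 : ℝ) ^ (-((d + 1) / 2 : ℝ)) ≠ 0 := by positivity
  field_simp
  field_simp at h3
  linear_combination h3

/-! ### Shape of the residual density. -/

lemma abs_le_sqrt_sub_one_iff {Ns : ℕ} (hNs : 3 ≤ Ns) (z : ℝ) :
    |z| ≤ √((Ns : ℝ) - 1) ↔ z ^ 2 / ((Ns : ℝ) - 1) ≤ 1 := by
  have hN : (3 : ℝ) ≤ Ns := by exact_mod_cast hNs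
  have hN1 : 0 < (Ns : ℝ) - 1 := by linarith
  rw [div_le_one hN1, ← sq_abs z]
  exact Real.le_sqrt (abs_nonneg z) hN1.le

lemma residualPDF_nonneg (Ns : ℕ) (hNs : 3 ≤ Ns) (z : ℝ) : 0 ≤ residualPDF Ns z := by
  have hN : (3 : ℝ) ≤ Ns := by exact_mod_cast hNs
  have h1 : 0 < Real.Gamma (((Ns : ℝ) - 1) / 2) := Real.Gamma_pos_of_pos (by linarith)
  have h2 : 0 < Real.Gamma (((Ns : ℝ) - 2) / 2) := Real.Gamma_pos_of_pos (by linarith)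
  unfold residualPDF
  split_ifs with h
  · have h4 := (abs_le_sqrt_sub_one_iff hNs z).1 h
    have h5 : 0 ≤ 1 - z ^ 2 / ((Ns : ℝ) - 1) := by linarith
    positivity
  · exact le_rfl

lemma measurable_residualPDF (Ns : ℕ) : Measurable (residualPDF Ns) := by
  unfold residualPDF
  refine Measurable.ite (measurableSet_le (by fun_prop) (by fun_prop)) (by fun_prop) (by fun_prop)

lemma residualPDF_le_of_abs_le {Ns : ℕ} (hNs : 4 ≤ Ns) {x y : ℝ} (h : |x| ≤ |y|) :
    residualPDF Ns y ≤ residualPDF Ns x := by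
  have hN : (4 : ℝ) ≤ Ns := by exact_mod_cast hNs
  by_cases hy : |y| ≤ √((Ns : ℝ) - 1)
  · have hy' := (abs_le_sqrt_sub_one_iff (by omega) y).1 hy
    have h1 : 0 < Real.Gamma (((Ns : ℝ) - 1) / 2) := Real.Gamma_pos_of_pos (by linarith)
    have h2 : 0 < Real.Gamma (((Ns : ℝ) - 2) / 2) := Real.Gamma_pos_of_pos (by linarith)
    rw [residualPDF, residualPDF, if_pos hy, if_pos (h.trans hy)]
    refine mul_le_mul_of_nonneg_left ?_ (by positivity)
    refine Real.rpow_le_rpow (by linarith) ?_ (by linarith)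
    have : x ^ 2 / ((Ns : ℝ) - 1) ≤ y ^ 2 / ((Ns : ℝ) - 1) :=
      div_le_div_of_nonneg_right (sq_le_sq.2 h) (by linarith)
    linarith
  · rw [residualPDF, if_neg hy]
    exact residualPDF_nonneg Ns (by omega) x

lemma isLogConcave_residualPDF {Ns : ℕ} (hNs : 4 ≤ Ns) : IsLogConcave (residualPDF Ns) := by
  have hN : (4 : ℝ) ≤ Ns := by exact_mod_cast hNs
  have nonneg := residualPDF_nonneg Ns (by omega)
  refine ⟨nonneg, fun x y a b ha hb hab => ?_⟩
  -- Zero weights are treated apart: since `0 ^ 0 = 1`, a vanishing density value kills the product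
  -- only under a positive weight.
  rcases ha.eq_or_lt with rfl | ha'
  · obtain rfl : b = 1 := by linarith
    simp
  rcases hb.eq_or_lt with rfl | hb'
  · obtain rfl : a = 1 := by linarith
    simp
  by_cases hx : |x| ≤ √((Ns : ℝ) - 1)
  swap
  · rw [residualPDF, if_neg hx, Real.zero_rpow ha'.ne', zero_mul]
    exact nonneg _
  by_cases hy : |y| ≤ √((Ns : ℝ) - 1)
  swap
  · rw [residualPDF.eq_1 Ns y, if_neg hy, Real.zero_rpow hb'.ne', mul_zero]
    exact nonneg _
  have hz : |a * x + b * y| ≤ √((Ns : ℝ) - 1) := by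
    rw [abs_le] at hx hy ⊢
    constructor <;> nlinarith
  rw [residualPDF, residualPDF, residualPDF, if_pos hx, if_pos hy, if_pos hz]
  rw [abs_le_sqrt_sub_one_iff (by omega)] at hx hy hz
  have h1 : 0 < Real.Gamma (((Ns : ℝ) - 1) / 2) := Real.Gamma_pos_of_pos (by linarith)
  have h2 : 0 < Real.Gamma (((Ns : ℝ) - 2) / 2) := Real.Gamma_pos_of_pos (by linarith)
  set C := Real.Gamma (((Ns : ℝ) - 1) / 2) /
        (√(Real.pi * ((Ns : ℝ) - 1)) * Real.Gamma (((Ns : ℝ) - 2) / 2))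
  have hC : 0 < C := by
    have : 0 < (Ns : ℝ) - 1 := by linarith
    positivity
  have hx0 : 0 ≤ 1 - x ^ 2 / ((Ns : ℝ) - 1) := by linarith
  have hy0 : 0 ≤ 1 - y ^ 2 / ((Ns : ℝ) - 1) := by linarith
  have hp : 0 ≤ ((Ns : ℝ) - 4) / 2 := by linarith
  rw [Real.mul_rpow hC.le (by positivity), Real.mul_rpow hC.le (by positivity),
    ← Real.rpow_mul hx0, ← Real.rpow_mul hy0, mul_comm _ a, mul_comm _ b, Real.rpow_mul hx0,
    Real.rpow_mul hy0]
  calc _ = C ^ (a + b) * ((1 - x ^ 2 / ((Ns : ℝ) - 1)) ^ a * (1 - y ^ 2 / ((Ns : ℝ) - 1)) ^ b) ^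
        (((Ns : ℝ) - 4) / 2) := by
        rw [Real.rpow_add hC, Real.mul_rpow (by positivity) (by positivity)]
        ring
    _ ≤ _ := by
      rw [hab, Real.rpow_one]
      refine mul_le_mul_of_nonneg_left (Real.rpow_le_rpow (by positivity) ?_ hp) hC.le
      -- Weighted AM-GM on the bases, then convexity of the square.
      refine (Real.geom_mean_le_arith_mean2_weighted ha hb hx0 hy0 hab).trans ?_
      have hsq : (a * x + b * y) ^ 2 ≤ a * x ^ 2 + b * y ^ 2 := by
        obtain rfl : b = 1 - a := by linarith
        nlinarith [mul_nonneg (mul_nonneg ha hb) (sq_nonneg (x - y))]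
      have := div_le_div_of_nonneg_right hsq (show 0 ≤ (Ns : ℝ) - 1 by linarith)
      rw [add_div, mul_div_assoc, mul_div_assoc] at this
      linear_combination this + hab

/-- A probability measure whose density increases before `c` and decreases after it is unimodal. -/
lemma isUnimodal_withDensity {f : ℝ → ℝ} (hf0 : ∀ x, 0 ≤ f x) (hfm : Measurable f)
    [IsFiniteMeasure (volume.withDensity (fun x => ENNReal.ofReal (f x)))] {c : ℝ}
    (hmono : MonotoneOn f (Iio c)) (hanti : AntitoneOn f (Ioi c)) :
    IsUnimodal (volume.withDensity (fun x => ENNReal.ofReal (f x))) := by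
  set μ := volume.withDensity (fun x => ENNReal.ofReal (f x))
  have hint : Integrable f := by
    refine ⟨hfm.aestronglyMeasurable, ?_⟩
    rw [hasFiniteIntegral_iff_ofReal (ae_of_all _ hf0), ← setLIntegral_univ,
      ← withDensity_apply _ MeasurableSet.univ]
    exact measure_lt_top μ _
  have hdiff : ∀ x y, x ≤ y → μ.real (Iic y) - μ.real (Iic x) = ∫ t in Ioc x y, f t := by
    intro x y hxy
    rw [← measureReal_sdiff (Iic_subset_Iic.2 hxy) measurableSet_Iic, Iic_sdiff_Iic, Measure.real,
      withDensity_apply _ measurableSet_Ioc, ← ofReal_integral_eq_lintegral_ofReal hint.integrableOn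
      (ae_of_all _ hf0), ENNReal.toReal_ofReal (integral_nonneg hf0)]
  have upper : ∀ x y m, x < y → (∀ t ∈ Ioc x y, f t ≤ m) →
      (μ.real (Iic y) - μ.real (Iic x)) / (y - x) ≤ m := by
    intro x y m hxy h
    rw [div_le_iff₀ (sub_pos.2 hxy), hdiff x y hxy.le]
    have := setIntegral_mono_on hint.integrableOn
      (integrableOn_const (C := m) (μ := volume) (by simp)) measurableSet_Ioc h
    simpa [hxy.le, mul_comm] using this
  have lower : ∀ x y m, x < y → (∀ t ∈ Ioc x y, m ≤ f t) →
      m ≤ (μ.real (Iic y) - μ.real (Iic x)) / (y - x) := by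
    intro x y m hxy h
    rw [le_div_iff₀ (sub_pos.2 hxy), hdiff x y hxy.le]
    have := setIntegral_mono_on (integrableOn_const (C := m) (μ := volume) (by simp))
      hint.integrableOn measurableSet_Ioc h
    simpa [hxy.le, mul_comm] using this
  -- Slopes of the distribution function are averages of `f`; the value `f y` separates the averages
  -- over two adjacent intervals.
  refine ⟨c, convexOn_of_slope_mono_adjacent (convex_Iio c) ?_,
    concaveOn_of_slope_anti_adjacent (convex_Ioi c) ?_⟩
  · intro x y z _ hz hxy hyz
    have hz : z < c := hz
    exact (upper x y (f y) hxy fun t ht =>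
      hmono (ht.2.trans_lt (hyz.trans hz)) (hyz.trans hz) ht.2).trans
      (lower y z (f y) hyz fun t ht => hmono (hyz.trans hz) (ht.2.trans_lt hz) ht.1.le)
  · intro x y z hx _ hxy hyz
    have hx : c < x := hx
    exact (upper y z (f y) hyz fun t ht =>
      hanti (hx.trans hxy) (hx.trans (hxy.trans ht.1)) ht.1.le).trans
      (lower x y (f y) hxy fun t ht => hanti (hx.trans ht.1) (hx.trans hxy) ht.2)

lemma isUnimodal_residualPDF {Ns : ℕ} (hNs : 4 ≤ Ns)
    [IsFiniteMeasure (volume.withDensity (fun z => ENNReal.ofReal (residualPDF Ns z)))] :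
    IsUnimodal (volume.withDensity (fun z => ENNReal.ofReal (residualPDF Ns z))) := by
  refine isUnimodal_withDensity (c := 0) (residualPDF_nonneg Ns (by omega))
    (measurable_residualPDF Ns) (fun x (hx : x < 0) y (hy : y < 0) h => ?_)
    (fun x (hx : 0 < x) y (hy : 0 < y) h => ?_)
  · exact residualPDF_le_of_abs_le hNs (by rw [abs_of_neg hx, abs_of_neg hy]; linarith)
  · exact residualPDF_le_of_abs_le hNs (by rwa [abs_of_pos hx, abs_of_pos hy])

/-! ### From the Student density to the residual density. -/

lemma hasDerivAt_mul_div_sqrt_one_add_sq (c t : ℝ) :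
    HasDerivAt (fun t : ℝ => c * (t / √(1 + t ^ 2))) (c * (1 + t ^ 2) ^ (-(3 / 2) : ℝ)) t := by
  have ht : 0 < 1 + t ^ 2 := by positivity
  have h1 : HasDerivAt (fun t : ℝ => 1 + t ^ 2) (2 * t) t := by
    simpa using (hasDerivAt_pow 2 t).const_add 1
  have h2 := ((hasDerivAt_id t).div (h1.sqrt ht.ne') (Real.sqrt_pos.2 ht).ne').const_mul c
  refine h2.congr_deriv ?_
  congr 1
  have hs := Real.sq_sqrt ht.le
  have hs' : √(1 + t ^ 2) ≠ 0 := (Real.sqrt_pos.2 ht).ne'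
  have h3 : (1 + t ^ 2) ^ (-(3 / 2) : ℝ) = (√(1 + t ^ 2) ^ 3)⁻¹ := by
    rw [Real.rpow_neg ht.le, Real.sqrt_eq_rpow, ← Real.rpow_mul_natCast ht.le]
    norm_num
  rw [h3]
  simp only [id]
  field_simp
  linear_combination hs

lemma image_mul_div_sqrt_one_add_sq {c : ℝ} (hc : 0 < c) :
    (fun t : ℝ => c * (t / √(1 + t ^ 2))) '' univ = Ioo (-c) c := by
  ext z
  simp only [image_univ, mem_range, mem_Ioo, ← abs_lt]
  constructor
  · rintro ⟨t, rfl⟩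
    have ht : 0 < 1 + t ^ 2 := by positivity
    rw [abs_mul, abs_of_pos hc, abs_div, abs_of_pos (Real.sqrt_pos.2 ht)]
    refine mul_lt_of_lt_one_right hc ?_
    rw [div_lt_one (Real.sqrt_pos.2 ht), Real.lt_sqrt (abs_nonneg t), sq_abs]
    linarith
  · intro hz
    have h1 : 0 < 1 - (z / c) ^ 2 := by
      rw [sub_pos, sq_lt_one_iff_abs_lt_one, abs_div, abs_of_pos hc]
      exact (div_lt_one hc).2 hz
    refine ⟨(z / c) / √(1 - (z / c) ^ 2), ?_⟩
    have h2 : 1 + ((z / c) / √(1 - (z / c) ^ 2)) ^ 2 = (√(1 - (z / c) ^ 2))⁻¹ ^ 2 := by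
      rw [div_pow _ √_, inv_pow, Real.sq_sqrt h1.le, ← one_div, eq_div_iff h1.ne', add_mul,
        div_mul_cancel₀ _ h1.ne']
      ring
    have h3 : √(1 - (z / c) ^ 2) ≠ 0 := (Real.sqrt_pos.2 h1).ne'
    rw [h2, Real.sqrt_sq (by positivity), div_inv_eq_mul, div_mul_cancel₀ _ h3,
      mul_div_cancel₀ _ hc.ne']

/-- Substitution `z = √(k+1) t / √(1+t²)`, an increasing bijection of `ℝ` onto the open support, for
which `1 - z²/(k+1) = 1/(1+t²)`. -/
lemma lintegral_residualPDF_eq {k : ℕ} (hk : 1 ≤ k) (g : ℝ → ENNReal) :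
    ∫⁻ t, g (√(k + 1) * (t / √(1 + t ^ 2))) * ENNReal.ofReal (Real.Gamma ((k + 1) / 2) /
        (√Real.pi * Real.Gamma (k / 2)) * (1 + t ^ 2) ^ (-((k + 1) / 2 : ℝ))) =
      ∫⁻ z, g z * ENNReal.ofReal (residualPDF (k + 2) z) := by
  have hk' : (1 : ℝ) ≤ k := by exact_mod_cast hk
  have hk1 : (0 : ℝ) < k + 1 := by linarith
  have hcast : ((k + 2 : ℕ) : ℝ) - 1 = k + 1 := by push_cast; ring
  set c : ℝ := √(k + 1) with hc
  have hc0 : 0 < c := Real.sqrt_pos.2 hk1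
  have hsupp : (fun z => g z * ENNReal.ofReal (residualPDF (k + 2) z)) =
      (Icc (-c) c).indicator (fun z => g z * ENNReal.ofReal (residualPDF (k + 2) z)) := by
    symm
    rw [indicator_eq_self]
    intro z hz
    by_contra h
    apply hz
    rw [mem_Icc, ← abs_le] at h
    simp only [residualPDF, hcast, ← hc, if_neg h, ENNReal.ofReal_zero, mul_zero]
  rw [hsupp, lintegral_indicator measurableSet_Icc, ← setLIntegral_congr Ioo_ae_eq_Icc,
    ← image_mul_div_sqrt_one_add_sq hc0, lintegral_image_eq_lintegral_abs_deriv_mul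
      MeasurableSet.univ
      (fun t _ => (hasDerivAt_mul_div_sqrt_one_add_sq c t).hasDerivWithinAt)
      (StrictMono.injective (strictMono_of_hasDerivAt_pos
        (hasDerivAt_mul_div_sqrt_one_add_sq c) fun t => by positivity)).injOn, setLIntegral_univ]
  congr 1 with t
  have ht : 0 < 1 + t ^ 2 := by positivity
  rw [mul_left_comm, ← ENNReal.ofReal_mul (abs_nonneg _)]
  congr 2
  have hmem : |c * (t / √(1 + t ^ 2))| ≤ c := by
    have : c * (t / √(1 + t ^ 2)) ∈ Ioo (-c) c := by
      rw [← image_mul_div_sqrt_one_add_sq hc0]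
      exact mem_image_of_mem _ (mem_univ t)
    exact abs_le.2 ⟨this.1.le, this.2.le⟩
  have hbase : 1 - (c * (t / √(1 + t ^ 2))) ^ 2 / (k + 1) = (1 + t ^ 2)⁻¹ := by
    rw [mul_pow, div_pow, Real.sq_sqrt ht.le, hc, Real.sq_sqrt hk1.le]
    field_simp
    ring
  rw [residualPDF, hcast, if_pos hmem, hbase, abs_of_pos (by positivity),
    Real.sqrt_mul Real.pi_pos.le, ← hc, Real.inv_rpow ht.le, ← Real.rpow_neg ht.le]
  -- The exponent splits into the Jacobian's `-3/2` and the density's `-(k-2)/2`.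
  have e1 : (-((k + 1) / 2) : ℝ) = -(3 / 2) + -((((k + 2 : ℕ) : ℝ) - 4) / 2) := by
    push_cast; ring
  have e2 : (((k + 2 : ℕ) : ℝ) - 2) / 2 = k / 2 := by push_cast; ring
  rw [e1, Real.rpow_add ht, e2]
  have hG : Real.Gamma (k / 2 : ℝ) ≠ 0 := (Real.Gamma_pos_of_pos (by positivity)).ne'
  field_simp

/-- The law of the normalized coordinate of a Gaussian vector of dimension `k + 1`. -/
lemma map_gaussianReal_prod_stdGaussian {k : ℕ} (hk : 1 ≤ k) :
    ((gaussianReal 0 1).prod (stdGaussian (EuclideanSpace ℝ (Fin k)))).map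
        (fun p => √(k + 1) * (p.1 / √(p.1 ^ 2 + ‖p.2‖ ^ 2))) =
      volume.withDensity (fun z => ENNReal.ofReal (residualPDF (k + 2) z)) := by
  have : Nonempty (Fin k) := ⟨⟨0, hk⟩⟩
  ext s hs
  have hm : Measurable (s.indicator (1 : ℝ → ENNReal)) := measurable_one.indicator hs
  have hf : Measurable (fun p : ℝ × EuclideanSpace ℝ (Fin k) =>
      √(k + 1) * (p.1 / √(p.1 ^ 2 + ‖p.2‖ ^ 2))) := by fun_prop
  rw [← lintegral_indicator_one hs, lintegral_map hm hf,
    lintegral_gaussianReal_prod_stdGaussian (F := fun p => s.indicator 1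
      (√(k + 1) * (p.1 / √(p.1 ^ 2 + ‖p.2‖ ^ 2)))) (g := fun t => s.indicator 1
      (√(k + 1) * (t / √(1 + t ^ 2)))) (hm.comp hf) (by fun_prop), finrank_euclideanSpace_fin,
    lintegral_residualPDF_eq hk, withDensity_apply _ hs, ← lintegral_indicator hs]
  · congr 1 with z
    by_cases hz : z ∈ s <;> simp [hz]
  · intro z hz t
    have hz' : 0 < ‖z‖ := norm_pos_iff.2 hz
    have h1 : (‖z‖ * t) ^ 2 + ‖z‖ ^ 2 = ‖z‖ ^ 2 * (1 + t ^ 2) := by ring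
    simp only [h1]
    rw [Real.sqrt_mul (by positivity), Real.sqrt_sq hz'.le, mul_div_mul_left _ _ hz'.ne']

/-! ### Orthogonal reduction of the residual. -/

/-- Coordinate `0` is discarded because it will carry the sample mean. -/
lemma map_pi_gaussianReal_split (k : ℕ) :
    (Measure.pi (fun _ : Fin (k + 2) => gaussianReal 0 1)).map
        (fun x => (x 1, WithLp.toLp 2 (fun j : Fin k => x j.succ.succ))) =
      (gaussianReal 0 1).prod (stdGaussian (EuclideanSpace ℝ (Fin k))) := by
  have h1 := measurePreserving_piFinSuccAbove (fun _ : Fin (k + 2) => gaussianReal 0 1) 0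
  have h2 := measurePreserving_piFinSuccAbove (fun _ : Fin (k + 1) => gaussianReal 0 1) 0
  have h3 : MeasurePreserving (WithLp.toLp 2) (Measure.pi (fun _ : Fin k => gaussianReal 0 1))
      (stdGaussian (EuclideanSpace ℝ (Fin k))) := ⟨by fun_prop, map_pi_eq_stdGaussian⟩
  exact (((MeasurePreserving.id _).prod h3).comp
    (h2.comp (measurePreserving_snd.comp h1))).map_eq

lemma studentizedResidual_const_add_mul {Ns : ℕ} (hNs : Ns ≠ 0) (m : ℝ) {s : ℝ} (hs : 0 < s)
    (x : Fin Ns → ℝ) (i : Fin Ns) :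
    studentizedResidual (fun j => m + s * x j) i = studentizedResidual x i := by
  have hN : (Ns : ℝ) ≠ 0 := by exact_mod_cast hNs
  have hmean : sampleMean (fun j => m + s * x j) = m + s * sampleMean x := by
    simp only [sampleMean, Finset.sum_add_distrib, ← Finset.mul_sum, Finset.sum_const,
      Finset.card_univ, Fintype.card_fin, nsmul_eq_mul]
    field_simp
  have hstd : sampleStd (fun j => m + s * x j) = s * sampleStd x := by
    rw [sampleStd, sampleStd, hmean, ← Real.sqrt_sq hs.le, ← Real.sqrt_mul (sq_nonneg s),
      Real.sqrt_sq hs.le]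
    congr 1
    simp only [Finset.mul_sum]
    congr 1 with j
    ring
  rw [studentizedResidual, studentizedResidual, hmean, hstd, add_sub_add_left_eq_sub, ← mul_sub,
    mul_div_mul_left _ _ hs.ne']

lemma sum_sub_sampleMean_sq {Ns : ℕ} (hNs : Ns ≠ 0) (y : Fin Ns → ℝ) :
    ∑ j, (y j - sampleMean y) ^ 2 = ∑ j, y j ^ 2 - Ns * sampleMean y ^ 2 := by
  have hN : (Ns : ℝ) ≠ 0 := by exact_mod_cast hNs
  have hs : ∑ j, y j = Ns * sampleMean y := by rw [sampleMean]; field_simp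
  simp only [sub_sq, Finset.sum_add_distrib, Finset.sum_sub_distrib, Finset.sum_const,
    Finset.card_univ, Fintype.card_fin, nsmul_eq_mul, ← Finset.sum_mul, ← Finset.mul_sum, hs]
  ring

/-- An orthonormal basis adapted to the sample mean and to the `i`-th residual. -/
lemma exists_orthonormalBasis_sampleMean_residual (k : ℕ) (i : Fin (k + 2)) :
    ∃ b : OrthonormalBasis (Fin (k + 2)) ℝ (EuclideanSpace ℝ (Fin (k + 2))),
      (∀ x, inner ℝ (b 0) x = √(k + 2) * sampleMean x.ofLp) ∧
      (∀ x, √(k + 1) * inner ℝ (b 1) x = √(k + 2) * (x i - sampleMean x.ofLp)) := by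
  have hk2 : (0 : ℝ) < k + 2 := by positivity
  have hk1 : (0 : ℝ) < k + 1 := by positivity
  have hs2 := Real.sq_sqrt hk2.le
  have hs1 := Real.sq_sqrt hk1.le
  have hp2 := Real.sqrt_pos.2 hk2
  have hp1 := Real.sqrt_pos.2 hk1
  let u : EuclideanSpace ℝ (Fin (k + 2)) := WithLp.toLp 2 fun _ => (√(k + 2))⁻¹
  -- The centred `i`-th unit vector has squared norm `1 - 1/(k+2) = (k+1)/(k+2)`, whence the
  -- prefactor.
  let e : EuclideanSpace ℝ (Fin (k + 2)) := WithLp.toLp 2 fun j =>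
    √(k + 2) / √(k + 1) * ((if j = i then 1 else 0) - (k + 2 : ℝ)⁻¹)
  have hu : ∀ x, inner ℝ u x = √(k + 2) * sampleMean x.ofLp := by
    intro x
    simp only [u, PiLp.inner_apply, sampleMean, RCLike.inner_apply, conj_trivial, ← Finset.sum_mul]
    push_cast
    field_simp
    rw [hs2]
  have he : ∀ x, √(k + 1) * inner ℝ e x = √(k + 2) * (x i - sampleMean x.ofLp) := by
    intro x
    have : inner ℝ e x = √(k + 2) / √(k + 1) * (x i - sampleMean x.ofLp) := by
      simp only [e, PiLp.inner_apply, sampleMean, RCLike.inner_apply, conj_trivial]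
      calc _ = √(k + 2) / √(k + 1) * ∑ j, ((if j = i then x j else 0) - (k + 2 : ℝ)⁻¹ * x j) := by
            rw [Finset.mul_sum]
            congr 1 with j
            split_ifs <;> ring
        _ = _ := by
            rw [Finset.sum_sub_distrib, ← Finset.mul_sum]
            simp
    rw [this]
    field_simp
  have hmu : sampleMean u.ofLp = (√(k + 2))⁻¹ := by
    simp only [u, sampleMean, Finset.sum_const, Finset.card_univ, Fintype.card_fin, nsmul_eq_mul]
    push_cast
    field_simp
  have hme : sampleMean e.ofLp = 0 := by
    simp only [e, sampleMean, ← Finset.mul_sum, Finset.sum_sub_distrib]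
    simp [hk2.ne']
  have huu : inner ℝ u u = 1 := by
    rw [hu, hmu]
    field_simp
  have hue : inner ℝ u e = 0 := by
    rw [hu, hme, mul_zero]
  have hee : inner ℝ e e = 1 := by
    have h := he e
    have hei : e i = √(k + 2) / √(k + 1) * (1 - (k + 2 : ℝ)⁻¹) := by simp [e]
    rw [hme, sub_zero, hei] at h
    have : √(k + 1) * inner ℝ e e = √(k + 1) * 1 := by
      rw [h]
      field_simp
      rw [hs1, hs2]
      ring
    exact mul_left_cancel₀ hp1.ne' this
  let v : Fin (k + 2) → EuclideanSpace ℝ (Fin (k + 2)) := fun j => if j = 0 then u else e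
  obtain ⟨b, hb⟩ := Orthonormal.exists_orthonormalBasis_extension_of_card_eq (𝕜 := ℝ)
    (E := EuclideanSpace ℝ (Fin (k + 2))) (ι := Fin (k + 2)) (v := v) (s := {0, 1})
    (by simp) (by
      rw [orthonormal_iff_ite]
      rintro ⟨p, rfl | rfl⟩ ⟨q, rfl | rfl⟩
      · simpa [v] using huu
      · simpa [v, Subtype.ext_iff] using hue
      · simpa [v, Subtype.ext_iff, real_inner_comm] using hue
      · simpa [v] using hee)
  have hb0 : b 0 = u := by rw [hb 0 (by simp)]; simp [v]
  have hb1 : b 1 = e := by rw [hb 1 (by simp)]; simp [v]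
  exact ⟨b, by rwa [hb0], by rwa [hb1]⟩

/-- By Parseval, the centred sum of squares is `∑ a j ^ 2` without the term `a 0 ^ 2`, which equals
`Ns` times the squared mean. -/
lemma studentizedResidual_eq_of_orthonormalBasis {k : ℕ} {i : Fin (k + 2)}
    (b : OrthonormalBasis (Fin (k + 2)) ℝ (EuclideanSpace ℝ (Fin (k + 2))))
    (h0 : ∀ x, inner ℝ (b 0) x = √(k + 2) * sampleMean x.ofLp)
    (h1 : ∀ x, √(k + 1) * inner ℝ (b 1) x = √(k + 2) * (x i - sampleMean x.ofLp))
    (a : Fin (k + 2) → ℝ) :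
    studentizedResidual (∑ j, a j • b j).ofLp i = √(k + 1) *
      (a 1 / √(a 1 ^ 2 + ‖(WithLp.toLp 2 fun j : Fin k => a j.succ.succ)‖ ^ 2)) := by
  have hk2 : (0 : ℝ) < k + 2 := by positivity
  have hp2 := Real.sqrt_pos.2 hk2
  set x := ∑ j, a j • b j with hx
  have hin : ∀ j, inner ℝ (b j) x = a j := fun j => b.orthonormal.inner_right_fintype a j
  have hnorm : ∑ j, x j ^ 2 = ∑ j, a j ^ 2 := by
    rw [← EuclideanSpace.real_norm_sq_eq, ← b.sum_sq_inner_right x]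
    simp [hin]
  have h0x := h0 x
  have h1x := h1 x
  rw [hin] at h0x h1x
  have hss : ∑ j, (x j - sampleMean x.ofLp) ^ 2
      = a 1 ^ 2 + ‖(WithLp.toLp 2 fun j : Fin k => a j.succ.succ)‖ ^ 2 := by
    rw [sum_sub_sampleMean_sq (by omega), hnorm, EuclideanSpace.real_norm_sq_eq,
      Fin.sum_univ_succ, Fin.sum_univ_succ, h0x, mul_pow, Real.sq_sqrt hk2.le]
    push_cast
    simp
  rw [studentizedResidual, sampleStd, hss, one_div, Real.sqrt_mul (by positivity), Real.sqrt_inv]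
  push_cast
  rw [← div_div, div_inv_eq_mul, mul_comm _ √((k : ℝ) + 2), ← h1x, mul_div_assoc]

/-! ### The law for Gaussian samples and for the system. -/

lemma measurable_studentizedResidual {Ns : ℕ} (i : Fin Ns) :
    Measurable (fun y : Fin Ns → ℝ => studentizedResidual y i) := by
  unfold studentizedResidual sampleStd sampleMean
  fun_prop

lemma map_studentizedResidual_pi_gaussianReal {Ns : ℕ} (hNs : 3 ≤ Ns) (i : Fin Ns) :
    (Measure.pi (fun _ : Fin Ns => gaussianReal 0 1)).map (fun y => studentizedResidual y i) =
      volume.withDensity (fun z => ENNReal.ofReal (residualPDF Ns z)) := by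
  obtain ⟨k, rfl⟩ : ∃ k, Ns = k + 2 := ⟨Ns - 2, by omega⟩
  obtain ⟨b, h0, h1⟩ := exists_orthonormalBasis_sampleMean_residual k i
  have hpi : Measure.pi (fun _ : Fin (k + 2) => gaussianReal 0 1) =
      (Measure.pi (fun _ : Fin (k + 2) => gaussianReal 0 1)).map
        (fun a => (∑ j, a j • b j).ofLp) := by
    have h := (map_pi_eq_stdGaussian (ι := Fin (k + 2))).trans
      (stdGaussian_eq_map_pi_orthonormalBasis b)
    have h' := congrArg (Measure.map WithLp.ofLp) h
    rw [Measure.map_map (by fun_prop) (by fun_prop), Measure.map_map (by fun_prop) (by fun_prop)]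
      at h'
    exact Measure.map_id.symm.trans h'
  rw [hpi, Measure.map_map (measurable_studentizedResidual i) (by fun_prop),
    ← map_gaussianReal_prod_stdGaussian (by omega), ← map_pi_gaussianReal_split,
    Measure.map_map (by fun_prop) (by fun_prop)]
  congr 1 with a
  exact studentizedResidual_eq_of_orthonormalBasis b h0 h1 a

/-- The law of the studentized residuals of independent samples of a real Gaussian. -/
lemma hasLaw_studentizedResidual {Ω : Type*} [MeasurableSpace Ω] {P : Measure Ω}
    [IsProbabilityMeasure P] {Ns : ℕ} (hNs : 3 ≤ Ns) {Y : Fin Ns → Ω → ℝ} {m : ℝ} {v : NNReal}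
    (hlaw : ∀ j, HasLaw (Y j) (gaussianReal m v) P) (hindep : iIndepFun Y P)
    (hstd : ∀ᵐ ω ∂P, 0 < sampleStd (fun j => Y j ω)) (i : Fin Ns) :
    HasLaw (fun ω => studentizedResidual (fun j => Y j ω) i)
      (volume.withDensity (fun z => ENNReal.ofReal (residualPDF Ns z))) P := by
  -- Zero variance would make all samples almost surely equal, hence the sample deviation zero.
  have hv : v ≠ 0 := by
    rintro rfl
    have hconst : ∀ᵐ ω ∂P, ∀ j, Y j ω = m := by
      rw [ae_all_iff]
      intro j
      have h := hlaw j
      rw [gaussianReal_zero_var] at h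
      exact h.ae_eq_of_dirac
    obtain ⟨ω, h1, h2⟩ := (hstd.and hconst).exists
    have hN : (Ns : ℝ) ≠ 0 := by
      have : Ns ≠ 0 := by omega
      exact_mod_cast this
    simp [sampleStd, sampleMean, h2, hN] at h1
  have hs : 0 < √(v : ℝ) := Real.sqrt_pos.2 (by positivity)
  have hX : ∀ j, HasLaw (fun ω => (Y j ω - m) / √(v : ℝ)) (gaussianReal 0 1) P := by
    intro j
    have h : HasLaw (fun y : ℝ => (y - m) / √(v : ℝ)) (gaussianReal 0 1) (gaussianReal m v) := by
      refine ⟨by fun_prop, ?_⟩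
      have := (Measure.map_map (μ := gaussianReal m v) (g := fun y : ℝ => y / √(v : ℝ))
        (f := fun y : ℝ => y - m) (by fun_prop) (by fun_prop)).symm
      rw [gaussianReal_map_sub_const, gaussianReal_map_div_const, sub_self, zero_div] at this
      refine this.trans (congrArg _ ?_)
      rw [div_eq_one_iff_eq (by simpa using hv)]
      ext
      simp
    exact h.fun_comp (hlaw j)
  have hXi : iIndepFun (fun j ω => (Y j ω - m) / √(v : ℝ)) P :=
    hindep.comp (fun _ y => (y - m) / √(v : ℝ)) fun _ => by fun_prop
  have hres : HasLaw (fun y : Fin Ns → ℝ => studentizedResidual y i)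
      (volume.withDensity (fun z => ENNReal.ofReal (residualPDF Ns z)))
      (Measure.pi (fun _ : Fin Ns => gaussianReal 0 1)) :=
    ⟨(measurable_studentizedResidual i).aemeasurable, map_studentizedResidual_pi_gaussianReal hNs i⟩
  refine (hres.fun_comp (hXi.hasLaw_pi hX)).congr (ae_of_all _ fun ω => ?_)
  simp only
  rw [← studentizedResidual_const_add_mul (by omega) m hs (fun j => (Y j ω - m) / √(v : ℝ))]
  congr 1 with j
  field_simp
  ring

theorem lemma1 {Ω : Type*} [MeasurableSpace Ω] (P : Measure Ω) [IsProbabilityMeasure P]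
    (n m N Ns : ℕ) (hNs : 3 ≤ Ns)
    (A : Matrix (Fin n) (Fin n) ℝ) (B : Matrix (Fin n) (Fin m) ℝ)
    (x₀ : Fin n → ℝ) (U : Fin N × Fin m → ℝ)
    -- the (unknown, possibly singular) Gaussian law of the concatenated disturbance
    (ν : Measure (Fin N × Fin n → ℝ)) [IsGaussian ν]
    -- independent samples of the concatenated disturbance
    (W : Fin Ns → Ω → (Fin N × Fin n → ℝ))
    (hlaw : ∀ j, HasLaw (W j) ν P) (hindep : iIndepFun W P)
    (k : ℕ) (hk1 : 1 ≤ k) (hkN : k ≤ N) (G : Fin n → ℝ)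
    -- the sample standard deviation of `G · x(k)` is almost surely positive
    (hstd : ∀ᵐ ω ∂P, 0 < sampleStd (fun j => G ⬝ᵥ LTI.state A B x₀ U (W j ω) k))
    (i : Fin Ns) :
    HasLaw (fun ω => studentizedResidual (fun j => G ⬝ᵥ LTI.state A B x₀ U (W j ω) k) i)
        (volume.withDensity (fun z => ENNReal.ofReal (residualPDF Ns z))) P ∧
      (4 ≤ Ns →
        IsLogConcave (residualPDF Ns) ∧
        IsUnimodal (P.map (fun ω =>
          studentizedResidual (fun j => G ⬝ᵥ LTI.state A B x₀ U (W j ω) k) i))) := by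
  let L : (Fin N × Fin n → ℝ) →L[ℝ] ℝ := LinearMap.toContinuousLinearMap
    (dotProductBilin ℝ ℝ G ∘ₗ (LTI.disturbanceMatrix N A k).mulVecLin)
  let a : ℝ := G ⬝ᵥ ((A ^ k).mulVec x₀ + (LTI.inputMatrix N A B k).mulVec U)
  have hY : ∀ w, G ⬝ᵥ LTI.state A B x₀ U w k = L w + a := by
    intro w
    rw [LTI.state, dotProduct_add, add_comm]
    rfl
  have hYm : Measurable fun w => G ⬝ᵥ LTI.state A B x₀ U w k := by
    simp only [hY]
    fun_prop
  have hYlaw : ∀ j, HasLaw (fun ω => G ⬝ᵥ LTI.state A B x₀ U (W j ω) k)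
      (gaussianReal (ν[L] + a) Var[L; ν].toNNReal) P := by
    intro j
    have h : HasLaw (fun w => G ⬝ᵥ LTI.state A B x₀ U w k)
        (gaussianReal (ν[L] + a) Var[L; ν].toNNReal) ν := by
      refine ⟨hYm.aemeasurable, ?_⟩
      rw [← gaussianReal_map_add_const, ← IsGaussian.map_eq_gaussianReal,
        Measure.map_map (by fun_prop) (by fun_prop)]
      congr 1 with w
      exact hY w
    exact h.fun_comp (hlaw j)
  have hres := hasLaw_studentizedResidual hNs hYlaw (hindep.comp _ fun _ => hYm) hstd i
  refine ⟨hres, fun h4 => ⟨isLogConcave_residualPDF h4, ?_⟩⟩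
  rw [hres.map_eq]
  -- Finiteness of the density's measure comes from its being the law of a random variable, without
  -- integrating it.
  have := hres.isFiniteMeasure_iff.1 inferInstance
  exact isUnimodal_residualPDF h4
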